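/- For $r>0$ let $S(r)=\sum_{n\ge 1}\frac{2n}{(n^2+r^2)^2}$ be the Mathieu series (which converges), and for real $c$ put $$F_c(r)=\frac{1}{r^2+\frac12-\frac{4r^2+1}{12}\,(r^2+c)^{-1}}.$$ Let $a=\frac{\zeta(3)}{6\zeta(3)-6}=0.9915168156\ldots$, where $\zeta$ is the Riemann zeta function, and $b=\frac{13}{30}$. Then $$F_a(r)<S(r)<F_b(r)\qquad\text{for all } r>0,$$ and both constants are best possible: if a real number $a'$ satisfies $F_{a'}(r)<S(r)$ for all $r>0$, then $a'\ge a$; and if a real number $b'$ satisfies $S(r)<F_{b'}(r)$ for all $r>0$, then $b'\le b$. -/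

import Mathlib

/-- The `n`-th term, `n = 0, 1, 2, …`, of the Mathieu series; the index is shifted by one, so
that it is the term `2m / (m ^ 2 + r ^ 2) ^ 2` with `m = n + 1`. -/
noncomputable def mathieuTerm (r : ℝ) (n : ℕ) : ℝ :=
  2 * ((n : ℝ) + 1) / (((n : ℝ) + 1) ^ 2 + r ^ 2) ^ 2

/-- The sum `S(r)` of the Mathieu series. -/
noncomputable def mathieuS (r : ℝ) : ℝ := ∑' n : ℕ, mathieuTerm r n

/-- The bounding function with parameter `c`. -/
noncomputable def mathieuBound (c r : ℝ) : ℝ :=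
  1 / (r ^ 2 + 1 / 2 - (4 * r ^ 2 + 1) / 12 * (r ^ 2 + c)⁻¹)

/-- The constant `ζ(3) / (6 ζ(3) - 6)`. -/
noncomputable def mathieuA : ℝ :=
  (riemannZeta 3).re / (6 * (riemannZeta 3).re - 6)

/-!
Write `t = r ^ 2` and `x = m ^ 2 - m + t`. The sequence `1 / (x + 1 / 2)` telescopes almost to the
Mathieu series, and `1 / (x + 1 / 2 - (t + 1 / 4) / (3 * F x))` does so better. A suitable rational
`F` makes its differences larger, another one smaller, than the terms of the series, so that its
value at `m = 1` bounds `S(r)` from above, respectively below. These values are `F_{13/30}(r)` and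
`F_c(r)` with `c = 13/30 + (8/15) / (t + 1/2)`. Since `F_c(r)` decreases in `c`, this gives the
upper bound, the optimality of `13/30` (let `r → ∞`), and the lower bound for `t ≥ 1/2`.

The constant `a` is determined by `F_a(0) = S(0)`. For `t ≤ 1/2` the decrease of `S` from its value
at `0`, bounded through the tangents of the terms, is smaller than that of `F_a`. For `c < a` the
function `F_c` takes the value `S(0)` at some `r > 0`, whereas `S(r) ≤ S(0)`.
-/

open Filter Topology

section Telescoping

variable {α : Type*} [AddCommGroup α] [PartialOrder α] [IsOrderedAddMonoid α] [TopologicalSpace α]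
  [IsTopologicalAddGroup α] [OrderClosedTopology α] {f H : ℕ → α} {N : ℕ}

theorem tsum_nat_add_le_of_le_sub_succ (hf : Summable f) (hH : Tendsto H atTop (𝓝 0))
    (h : ∀ n, N ≤ n → f n ≤ H n - H (n + 1)) : ∑' n, f (n + N) ≤ H N := by
  have hsum := ((summable_nat_add_iff N).2 hf).hasSum.tendsto_sum_nat
  have htel : Tendsto (fun n => H N - H (n + N)) atTop (𝓝 (H N)) := by
    simpa using tendsto_const_nhds.sub ((tendsto_add_atTop_iff_nat N).2 hH)
  refine le_of_tendsto_of_tendsto' hsum htel fun n => ?_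
  calc ∑ i ∈ Finset.range n, f (i + N)
      ≤ ∑ i ∈ Finset.range n, (H (i + N) - H (i + 1 + N)) :=
        Finset.sum_le_sum fun i _ => by simpa only [add_right_comm] using h (i + N) (by simp)
    _ = H N - H (n + N) := by rw [Finset.sum_range_sub' (fun i => H (i + N)), zero_add]

theorem tsum_nat_add_lt_of_lt_sub_succ (hf : Summable f) (hH : Tendsto H atTop (𝓝 0))
    (h : ∀ n, N ≤ n → f n < H n - H (n + 1)) : ∑' n, f (n + N) < H N := by
  have htail : ∑' n, f (n + (N + 1)) ≤ H (N + 1) :=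
    tsum_nat_add_le_of_le_sub_succ hf hH fun n hn => (h n (by lia)).le
  calc ∑' n, f (n + N) = f N + ∑' n, f (n + (N + 1)) := by
        rw [((summable_nat_add_iff N).2 hf).tsum_eq_zero_add, zero_add]
        simp only [add_right_comm, add_assoc]
    _ < H N - H (N + 1) + H (N + 1) := add_lt_add_of_lt_of_le (h N le_rfl) htail
    _ = H N := sub_add_cancel _ _

theorem lt_tsum_nat_add_of_sub_succ_lt (hf : Summable f) (hH : Tendsto H atTop (𝓝 0))
    (h : ∀ n, N ≤ n → H n - H (n + 1) < f n) : H N < ∑' n, f (n + N) := by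
  have hneg : ∑' n, -f (n + N) < -H N :=
    tsum_nat_add_lt_of_lt_sub_succ (f := fun n => -f n) (H := fun n => -H n) hf.neg
      (by simpa using hH.neg) fun n hn => by simpa [neg_add_eq_sub] using neg_lt_neg (h n hn)
  rwa [tsum_neg, neg_lt_neg_iff] at hneg

end Telescoping

section MathieuSeries

theorem mathieuTerm_nonneg (r : ℝ) (n : ℕ) : 0 ≤ mathieuTerm r n := by
  unfold mathieuTerm
  positivity

theorem mathieuTerm_le_mathieuTerm_zero (r : ℝ) (n : ℕ) : mathieuTerm r n ≤ mathieuTerm 0 n := by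
  unfold mathieuTerm
  gcongr _ / ?_ ^ 2
  simpa using sq_nonneg r

theorem mathieuTerm_zero (n : ℕ) : mathieuTerm 0 n = 2 * (1 / ((n : ℝ) + 1) ^ 3) := by
  unfold mathieuTerm
  field_simp
  ring

theorem summable_mathieuTerm (r : ℝ) : Summable (mathieuTerm r) := by
  have hcube : Summable fun n : ℕ => 1 / ((n : ℝ) + 1) ^ 3 := by
    simpa using (summable_nat_add_iff 1).2 (Real.summable_one_div_nat_pow.2 (by norm_num : 1 < 3))
  refine (hcube.mul_left 2).of_nonneg_of_le (mathieuTerm_nonneg r) fun n => ?_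
  exact (mathieuTerm_le_mathieuTerm_zero r n).trans_eq (mathieuTerm_zero n)

theorem mathieuS_le_mathieuS_zero (r : ℝ) : mathieuS r ≤ mathieuS 0 :=
  (summable_mathieuTerm r).tsum_le_tsum (mathieuTerm_le_mathieuTerm_zero r)
    (summable_mathieuTerm 0)

theorem mathieuS_eq_sum_add_tsum (r : ℝ) (N : ℕ) :
    mathieuS r = ∑ n ∈ Finset.range N, mathieuTerm r n + ∑' n, mathieuTerm r (n + N) :=
  ((summable_mathieuTerm r).sum_add_tsum_nat_add N).symm

theorem mathieuS_zero : mathieuS 0 = 2 * (riemannZeta 3).re := by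
  have hzeta : riemannZeta 3 = ((∑' n : ℕ, 1 / ((n : ℝ) + 1) ^ 3 : ℝ) : ℂ) := by
    rw [zeta_eq_tsum_one_div_nat_add_one_cpow (by norm_num), Complex.ofReal_tsum]
    refine tsum_congr fun n => ?_
    push_cast
    norm_cast
  rw [hzeta, Complex.ofReal_re, ← tsum_mul_left]
  exact tsum_congr mathieuTerm_zero

end MathieuSeries

section Telescopers

/-- The denominator `x + 1 / 2 - κ / w` with `κ = (t + 1 / 4) / 3`, which specialises to that of
`mathieuBound c r` for `t = x = r ^ 2` and `w = r ^ 2 + c`. The constant `κ` corrects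
`1 / u m - 1 / u (m + 1) = 2 * m / ((m ^ 2 + t) ^ 2 + t + 1 / 4)`, `u m = m ^ 2 - m + t + 1 / 2`,
to leading order. -/
noncomputable def mathieuDenom (t x w : ℝ) : ℝ := x + 1 / 2 - (4 * t + 1) / 12 * w⁻¹

/-- An approximation to the tail `∑ k ≥ m, 2 * k / (k ^ 2 + t) ^ 2`, with a correction `F` still
to be chosen, evaluated at `x = m ^ 2 - m + t`. -/
noncomputable def mathieuTelescoper (t : ℝ) (F : ℝ → ℝ) (m : ℝ) : ℝ :=
  1 / mathieuDenom t (m ^ 2 - m + t) (F (m ^ 2 - m + t))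

/-- The correction giving a telescoper whose differences are smaller than the terms of the
Mathieu series; the factor `16 / 15` makes `lowerFrac t t - t` tend to `13 / 30` as `t → ∞`. -/
noncomputable def lowerFrac (t x : ℝ) : ℝ := x + 3 / 2 - 16 / 15 * t / (x + 1 / 2)

/-- The correction giving a telescoper whose differences are larger than the terms of the
Mathieu series; the coefficients are chosen so that `upperFrac t t = t + 13 / 30`. The division
by `x` returns the junk value `0` only for `x = 0`, a case that is never used. -/
noncomputable def upperFrac (t x : ℝ) : ℝ :=
  x + 3 / 2 - (16 / 15 * t + 8 / 5) / (x + 7 / 2 - 2 * t / x)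

theorem add_le_mathieuDenom {t w : ℝ} (ht : 0 ≤ t) (hw : t + 1 / 4 ≤ w) (x : ℝ) :
    x + 1 / 6 ≤ mathieuDenom t x w := by
  have hw0 : 0 < w := by linarith
  have hcorr : (4 * t + 1) / 12 * w⁻¹ ≤ 1 / 3 := by
    rw [← div_eq_mul_inv, div_le_iff₀ hw0]
    linarith
  unfold mathieuDenom
  linarith

theorem mathieuDenom_pos {t x w : ℝ} (ht : 0 ≤ t) (hx : 0 ≤ x) (hw : t + 1 / 4 ≤ w) :
    0 < mathieuDenom t x w := by
  linarith [add_le_mathieuDenom ht hw x]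

theorem one_div_mathieuDenom_div {t x p q : ℝ} (ht : 0 ≤ t) (hx : 0 ≤ x) (hq : 0 < q)
    (hpq : t + 1 / 4 ≤ p / q) :
    0 < (x + 1 / 2) * p - (4 * t + 1) / 12 * q ∧
      1 / mathieuDenom t x (p / q) = p / ((x + 1 / 2) * p - (4 * t + 1) / 12 * q) := by
  have hp : 0 < p := (div_pos_iff_of_pos_right hq).1 (by linarith)
  have hden : (x + 1 / 2) * p - (4 * t + 1) / 12 * q = mathieuDenom t x (p / q) * p := by
    unfold mathieuDenom
    field_simp
  rw [hden]
  exact ⟨mul_pos (mathieuDenom_pos ht hx hpq) hp, by field_simp⟩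

theorem mathieuTelescoper_one (r : ℝ) (F : ℝ → ℝ) :
    mathieuTelescoper (r ^ 2) F 1 = mathieuBound (F (r ^ 2) - r ^ 2) r := by
  simp [mathieuTelescoper, mathieuDenom, mathieuBound]

theorem tendsto_mathieuTelescoper {t : ℝ} {F : ℝ → ℝ} (ht : 0 ≤ t)
    (hF : ∀ x, 0 < x → t ≤ x → t + 1 / 4 ≤ F x) :
    Tendsto (mathieuTelescoper t F) atTop (𝓝 0) := by
  have hlin : Tendsto (fun m : ℝ => m - 1) atTop atTop :=
    tendsto_atTop_add_const_right _ _ tendsto_id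
  refine (tendsto_const_nhds (x := 1)).div_atTop (tendsto_atTop_mono' _ ?_ hlin)
  filter_upwards [eventually_gt_atTop 1] with m hm
  have hx : m - 1 ≤ m ^ 2 - m := by nlinarith
  have hF' := hF (m ^ 2 - m + t) (by linarith) (by linarith)
  linarith [add_le_mathieuDenom ht hF' (m ^ 2 - m + t)]

theorem add_le_lowerFrac {t x : ℝ} (hx : 0 ≤ x) (htx : t ≤ x) : x + 13 / 30 ≤ lowerFrac t x := by
  have hx0 : 0 < x + 1 / 2 := by linarith
  have hfrac : 16 / 15 * t / (x + 1 / 2) ≤ 16 / 15 := by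
    rw [div_le_iff₀ hx0]
    linarith
  unfold lowerFrac
  linarith

theorem lowerFrac_self {t : ℝ} (ht : 0 ≤ t) :
    lowerFrac t t = t + (13 / 30 + 8 / 15 / (t + 1 / 2)) := by
  unfold lowerFrac
  field_simp
  ring

theorem add_le_upperFrac {t x : ℝ} (hx : 0 < x) (htx : t ≤ x) :
    x + 13 / 30 ≤ upperFrac t x := by
  have hquot : 2 * t / x ≤ 2 := by
    rw [div_le_iff₀ hx]
    linarith
  have hfrac : (16 / 15 * t + 8 / 5) / (x + 7 / 2 - 2 * t / x) ≤ 16 / 15 := by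
    rw [div_le_iff₀ (by linarith)]
    linarith
  unfold upperFrac
  linarith

theorem upperFrac_self {t : ℝ} (ht : 0 < t) : upperFrac t t = t + 13 / 30 := by
  have hquot : (16 / 15 * t + 8 / 5) / (t + 7 / 2 - 2) = 16 / 15 := by
    rw [div_eq_iff (by linarith)]
    ring
  rw [upperFrac, mul_div_cancel_right₀ _ ht.ne', hquot]
  ring

/-- The numerator of `lowerFrac t x` over the denominator `x + 1 / 2`. -/
noncomputable def lowerNum (t x : ℝ) : ℝ := (x + 3 / 2) * (x + 1 / 2) - 16 / 15 * t

theorem lowerNum_div {t x : ℝ} (hx : 0 ≤ x) : lowerNum t x / (x + 1 / 2) = lowerFrac t x := by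
  rw [lowerNum, lowerFrac, sub_div, mul_div_cancel_right₀ _ (by positivity)]

theorem one_div_mathieuDenom_lowerFrac {t x : ℝ} (ht : 0 ≤ t) (htx : t ≤ x) :
    0 < (x + 1 / 2) * lowerNum t x - (4 * t + 1) / 12 * (x + 1 / 2) ∧
      1 / mathieuDenom t x (lowerFrac t x) =
        lowerNum t x / ((x + 1 / 2) * lowerNum t x - (4 * t + 1) / 12 * (x + 1 / 2)) := by
  have hx : 0 ≤ x := ht.trans htx
  have hfrac : t + 1 / 4 ≤ lowerFrac t x := by linarith [add_le_lowerFrac hx htx]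
  rw [← lowerNum_div hx] at hfrac ⊢
  exact one_div_mathieuDenom_div ht hx (by positivity) hfrac

theorem mathieuTelescoper_lowerFrac_sub_lt {t m : ℝ} (ht : 0 ≤ t) (hm : 1 ≤ m) :
    mathieuTelescoper t (lowerFrac t) m - mathieuTelescoper t (lowerFrac t) (m + 1) <
      2 * m / (m ^ 2 + t) ^ 2 := by
  obtain ⟨hpos, heq⟩ :=
    one_div_mathieuDenom_lowerFrac ht (by nlinarith : t ≤ m ^ 2 - m + t)
  obtain ⟨hpos', heq'⟩ :=
    one_div_mathieuDenom_lowerFrac ht (by nlinarith : t ≤ (m + 1) ^ 2 - (m + 1) + t)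
  have hgap : 0 < m * (8 / 9 * (4 * t + 1) * (m ^ 2 - 4 / 5 * t) ^ 2 + 8 / 5 * t ^ 2
      + 58 / 45 * t + 2 / 9) := by positivity
  rw [mathieuTelescoper, mathieuTelescoper, heq, heq', div_sub_div _ _ hpos.ne' hpos'.ne',
    div_lt_div_iff₀ (mul_pos hpos hpos') (by positivity), ← sub_pos]
  refine hgap.trans_eq ?_
  unfold lowerNum
  ring

/-- The denominator of `upperFrac t x`, cleared of its inner fraction. -/
noncomputable def upperQuad (t x : ℝ) : ℝ := x ^ 2 + 7 / 2 * x - 2 * t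

/-- The numerator of `upperFrac t x` over the denominator `upperQuad t x`. -/
noncomputable def upperNum (t x : ℝ) : ℝ :=
  (x + 3 / 2) * upperQuad t x - x * (16 / 15 * t + 8 / 5)

theorem upperQuad_pos {t x : ℝ} (hx : 0 < x) (htx : t ≤ x) : 0 < upperQuad t x := by
  unfold upperQuad
  nlinarith

theorem upperNum_div {t x : ℝ} (hx : 0 < x) (htx : t ≤ x) :
    upperNum t x / upperQuad t x = upperFrac t x := by
  have hquot : x + 7 / 2 - 2 * t / x = upperQuad t x / x := by
    unfold upperQuad
    field_simp
  rw [upperNum, upperFrac, hquot, sub_div, mul_div_cancel_right₀ _ (upperQuad_pos hx htx).ne',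
    div_div_eq_mul_div, mul_comm x]

theorem one_div_mathieuDenom_upperFrac {t x : ℝ} (hx : 0 < x) (ht : 0 ≤ t) (htx : t ≤ x) :
    0 < (x + 1 / 2) * upperNum t x - (4 * t + 1) / 12 * upperQuad t x ∧
      1 / mathieuDenom t x (upperFrac t x) =
        upperNum t x / ((x + 1 / 2) * upperNum t x - (4 * t + 1) / 12 * upperQuad t x) := by
  have hfrac : t + 1 / 4 ≤ upperFrac t x := by linarith [add_le_upperFrac hx htx]
  rw [← upperNum_div hx htx] at hfrac ⊢
  exact one_div_mathieuDenom_div ht hx.le (upperQuad_pos hx htx) hfrac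

/-- The excess of the difference of the upper telescopers over the term of the Mathieu series,
cleared of denominators and divided by `m`, as a polynomial in `q = m ^ 2 - 1`. -/
noncomputable def upperGap (t q : ℝ) : ℝ :=
  1108 / 75 * t + 3166 / 45 * t ^ 2 + 10366 / 225 * t ^ 3 + 932 / 225 * t ^ 4 + 16 / 75 * t ^ 5
    + q * (-358 / 225 + 2338 / 225 * t + 2016 / 25 * t ^ 2 + 832 / 15 * t ^ 3 + 896 / 225 * t ^ 4)
    + q ^ 2 * (442 / 225 + 2614 / 225 * t + 3896 / 225 * t ^ 2 + 2048 / 225 * t ^ 3)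
    + q ^ 3 * (4 + 160 / 9 * t + 64 / 9 * t ^ 2)
    + q ^ 4 * (4 / 9 + 16 / 9 * t)

theorem upperGap_pos {t q : ℝ} (ht : 0 ≤ t) (hq : q = 0 ∧ 0 < t ∨ 1 ≤ q) : 0 < upperGap t q := by
  unfold upperGap
  rcases hq with ⟨rfl, ht0⟩ | hq
  · simp only [zero_mul, add_zero, ne_eq, OfNat.ofNat_ne_zero, not_false_eq_true, zero_pow]
    positivity
  · obtain ⟨p, hp, rfl⟩ : ∃ p, 0 ≤ p ∧ q = 1 + p := ⟨q - 1, by linarith, by ring⟩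
    ring_nf
    positivity

-- For `t = 0` the inequality fails when `m` is slightly larger than `1`.
theorem lt_mathieuTelescoper_upperFrac_sub {t m : ℝ} (ht : 0 ≤ t) (hm : m = 1 ∧ 0 < t ∨ 2 ≤ m) :
    2 * m / (m ^ 2 + t) ^ 2 <
      mathieuTelescoper t (upperFrac t) m - mathieuTelescoper t (upperFrac t) (m + 1) := by
  have hm1 : 1 ≤ m := by rcases hm with ⟨rfl, -⟩ | hm <;> linarith
  have hx : 0 < m ^ 2 - m + t := by rcases hm with ⟨rfl, ht0⟩ | hm <;> nlinarith
  obtain ⟨hpos, heq⟩ := one_div_mathieuDenom_upperFrac hx ht (by nlinarith)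
  obtain ⟨hpos', heq'⟩ := one_div_mathieuDenom_upperFrac
    (by nlinarith : 0 < (m + 1) ^ 2 - (m + 1) + t) ht (by nlinarith)
  have hgap : 0 < m * upperGap t (m ^ 2 - 1) := by
    refine mul_pos (by linarith) (upperGap_pos ht ?_)
    rcases hm with ⟨rfl, ht0⟩ | hm
    · exact .inl ⟨by norm_num, ht0⟩
    · exact .inr (by nlinarith)
  rw [mathieuTelescoper, mathieuTelescoper, heq, heq', div_sub_div _ _ hpos.ne' hpos'.ne',
    div_lt_div_iff₀ (by positivity) (mul_pos hpos hpos'), ← sub_pos]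
  refine hgap.trans_eq ?_
  unfold upperGap upperNum upperQuad
  ring

theorem sum_add_mathieuTelescoper_lt_mathieuS (r : ℝ) (N : ℕ) :
    ∑ n ∈ Finset.range N, mathieuTerm r n + mathieuTelescoper (r ^ 2) (lowerFrac (r ^ 2)) (N + 1) <
      mathieuS r := by
  have hr : 0 ≤ r ^ 2 := sq_nonneg r
  have hlim : Tendsto (mathieuTelescoper (r ^ 2) (lowerFrac (r ^ 2))) atTop (𝓝 0) :=
    tendsto_mathieuTelescoper hr fun x hx hrx => by linarith [add_le_lowerFrac hx.le hrx]
  rw [mathieuS_eq_sum_add_tsum r N, add_lt_add_iff_left]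
  refine lt_tsum_nat_add_of_sub_succ_lt
    (H := fun n : ℕ => mathieuTelescoper (r ^ 2) (lowerFrac (r ^ 2)) (n + 1))
    (summable_mathieuTerm r)
    (hlim.comp (tendsto_atTop_add_const_right _ 1 tendsto_natCast_atTop_atTop)) fun n _ => ?_
  push_cast
  exact mathieuTelescoper_lowerFrac_sub_lt hr (by simp)

theorem mathieuS_lt_sum_add_mathieuTelescoper {r : ℝ} {N : ℕ} (h : r ≠ 0 ∨ N ≠ 0) :
    mathieuS r < ∑ n ∈ Finset.range N, mathieuTerm r n +
      mathieuTelescoper (r ^ 2) (upperFrac (r ^ 2)) (N + 1) := by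
  have hr : 0 ≤ r ^ 2 := sq_nonneg r
  have hlim : Tendsto (mathieuTelescoper (r ^ 2) (upperFrac (r ^ 2))) atTop (𝓝 0) :=
    tendsto_mathieuTelescoper hr fun x hx hrx => by linarith [add_le_upperFrac hx hrx]
  rw [mathieuS_eq_sum_add_tsum r N, add_lt_add_iff_left]
  refine tsum_nat_add_lt_of_lt_sub_succ
    (H := fun n : ℕ => mathieuTelescoper (r ^ 2) (upperFrac (r ^ 2)) (n + 1))
    (summable_mathieuTerm r)
    (hlim.comp (tendsto_atTop_add_const_right _ 1 tendsto_natCast_atTop_atTop)) fun n hn => ?_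
  push_cast
  refine lt_mathieuTelescoper_upperFrac_sub hr ?_
  rcases n.eq_zero_or_pos with rfl | hn0
  · exact .inl ⟨by simp, by have := h.resolve_right (by simpa using hn); positivity⟩
  · have : (1 : ℝ) ≤ n := by exact_mod_cast hn0
    exact .inr (by linarith)

end Telescopers

section NumericalBounds

theorem lt_riemannZeta_three : 1.202056903138090 < (riemannZeta 3).re := by
  have h := sum_add_mathieuTelescoper_lt_mathieuS 0 12
  norm_num [mathieuS_zero, Finset.sum_range_succ, mathieuTerm, mathieuTelescoper, mathieuDenom,
    lowerFrac] at h
  norm_num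
  linarith

theorem riemannZeta_three_lt : (riemannZeta 3).re < 1.202056903162585 := by
  have h := mathieuS_lt_sum_add_mathieuTelescoper (r := 0) (N := 12) (.inr (by norm_num))
  norm_num [mathieuS_zero, Finset.sum_range_succ, mathieuTerm, mathieuTelescoper, mathieuDenom,
    upperFrac] at h
  norm_num
  linarith

theorem le_mathieuA : 0.9915168156 ≤ mathieuA := by
  have hlower := lt_riemannZeta_three
  have hupper := riemannZeta_three_lt
  norm_num at hlower hupper
  rw [mathieuA, le_div_iff₀ (by linarith)]
  norm_num
  linarith

theorem mathieuA_lt : mathieuA < 0.9915168157 := by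
  have hlower := lt_riemannZeta_three
  norm_num at hlower
  rw [mathieuA, div_lt_iff₀ (by linarith)]
  norm_num
  linarith

end NumericalBounds

section Bounds

theorem mathieuBound_zero (c : ℝ) : mathieuBound c 0 = 1 / mathieuDenom 0 0 c := by
  simp [mathieuBound, mathieuDenom]

theorem mathieuBound_mathieuA_zero : mathieuBound mathieuA 0 = mathieuS 0 := by
  have hzeta := lt_riemannZeta_three
  norm_num at hzeta
  have hpos : (riemannZeta 3).re ≠ 0 := by linarith
  have hden : mathieuDenom 0 0 mathieuA = 1 / (2 * (riemannZeta 3).re) := by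
    rw [mathieuDenom, mathieuA, inv_div]
    field_simp
    ring
  rw [mathieuBound_zero, hden, one_div_one_div, mathieuS_zero]

theorem mathieuBound_strictAntiOn (r : ℝ) :
    StrictAntiOn (fun c => mathieuBound c r) (Set.Ici (1 / 4)) := by
  intro c (hc : 1 / 4 ≤ c) d _ hcd
  have hr : 0 ≤ r ^ 2 := sq_nonneg r
  have hpos := mathieuDenom_pos hr hr (by linarith : r ^ 2 + 1 / 4 ≤ r ^ 2 + c)
  unfold mathieuDenom at hpos
  simp only [mathieuBound]
  have : 0 < r ^ 2 + c := by linarith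
  gcongr

theorem mathieuS_lt_mathieuBound {r : ℝ} (hr : r ≠ 0) : mathieuS r < mathieuBound (13 / 30) r := by
  simpa [mathieuTelescoper_one, upperFrac_self (sq_pos_of_ne_zero hr)] using
    mathieuS_lt_sum_add_mathieuTelescoper (N := 0) (.inl hr)

theorem mathieuBound_add_div_lt_mathieuS (r : ℝ) :
    mathieuBound (13 / 30 + 8 / 15 / (r ^ 2 + 1 / 2)) r < mathieuS r := by
  simpa [mathieuTelescoper_one, lowerFrac_self (sq_nonneg r)] using
    sum_add_mathieuTelescoper_lt_mathieuS r 0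

theorem mathieuBound_mathieuA_lt_mathieuS_of_le_sq {r : ℝ} (hr : 1 / 2 ≤ r ^ 2) :
    mathieuBound mathieuA r < mathieuS r := by
  have hA := le_mathieuA
  norm_num at hA
  have hfrac : 8 / 15 / (r ^ 2 + 1 / 2) ≤ 8 / 15 := div_le_self (by norm_num) (by linarith)
  have hpos : 0 ≤ 8 / 15 / (r ^ 2 + 1 / 2) := by positivity
  refine (mathieuBound_strictAntiOn r ?_ ?_ ?_).trans (mathieuBound_add_div_lt_mathieuS r)
  · rw [Set.mem_Ici]
    linarith
  · rw [Set.mem_Ici]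
    linarith
  · linarith

end Bounds

section NearZero

theorem four_div_pow_five_le_sub {m : ℝ} (hm : 2 ≤ m) :
    4 / m ^ 5 ≤ 1 / (m ^ 2 - m + 1 / 2) ^ 2 - 1 / ((m + 1) ^ 2 - (m + 1) + 1 / 2) ^ 2 := by
  have h1 : 0 < m ^ 2 - m + 1 / 2 := by nlinarith
  have h2 : 0 < (m + 1) ^ 2 - (m + 1) + 1 / 2 := by nlinarith
  rw [div_sub_div _ _ (by positivity) (by positivity),
    div_le_div_iff₀ (by positivity) (by positivity)]
  have hprod : (m ^ 2 - m + 1 / 2) * ((m + 1) ^ 2 - (m + 1) + 1 / 2) = m ^ 4 + 1 / 4 := by ring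
  have hgap : 0 ≤ 2 * m ^ 4 * (m ^ 2 - 1) - 1 / 4 := by
    nlinarith [pow_le_pow_left₀ (by norm_num) hm 4]
  rw [← mul_pow, hprod, ← sub_nonneg]
  refine hgap.trans_eq ?_
  ring

theorem tangent_le_mathieuTerm (r : ℝ) (n : ℕ) :
    mathieuTerm 0 n - r ^ 2 * (4 / ((n : ℝ) + 1) ^ 5) ≤ mathieuTerm r n := by
  have hgap : 0 ≤ (6 * ((n : ℝ) + 1) ^ 2 * r ^ 4 + 4 * r ^ 6) /
      (((n : ℝ) + 1) ^ 5 * (((n : ℝ) + 1) ^ 2 + r ^ 2) ^ 2) := by positivity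
  rw [← sub_nonneg]
  refine hgap.trans_eq ?_
  rw [mathieuTerm_zero, mathieuTerm]
  field_simp
  ring

/-- An upper bound for `(mathieuS 0 - mathieuS r) / r ^ 2` at `t = r ^ 2`: the first summand is
the exact contribution of the first term of the series, the second bounds that of all others. -/
noncomputable def mathieuSlope (t : ℝ) : ℝ := 2 * (2 + t) / (1 + t) ^ 2 + 4 / 25

theorem mathieuS_zero_sub_le (r : ℝ) : mathieuS 0 - r ^ 2 * mathieuSlope (r ^ 2) ≤ mathieuS r := by
  set H : ℝ → ℝ := fun m => r ^ 2 * (1 / (m ^ 2 - m + 1 / 2) ^ 2) with hH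
  have hlim : Tendsto H atTop (𝓝 0) := by
    have hsq : Tendsto (fun m : ℝ => (m ^ 2 - m + 1 / 2) ^ 2) atTop atTop := by
      refine tendsto_atTop_mono (fun m => ?_) (tendsto_atTop_add_const_right _ (-1) tendsto_id)
      rw [id]
      nlinarith [sq_nonneg (m - 1), sq_nonneg (m ^ 2 - m)]
    simpa [hH] using ((tendsto_const_nhds (x := (1 : ℝ))).div_atTop hsq).const_mul (r ^ 2)
  have htail : ∑' n, (mathieuTerm 0 (n + 1) - mathieuTerm r (n + 1)) ≤ H ((1 : ℕ) + 1) := by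
    refine tsum_nat_add_le_of_le_sub_succ (H := fun n : ℕ => H (n + 1))
      ((summable_mathieuTerm 0).sub (summable_mathieuTerm r))
      (hlim.comp (tendsto_atTop_add_const_right _ 1 tendsto_natCast_atTop_atTop)) fun n hn => ?_
    have hm : (2 : ℝ) ≤ n + 1 := by exact_mod_cast Nat.succ_le_succ hn
    have hdiff := mul_le_mul_of_nonneg_left (four_div_pow_five_le_sub hm) (sq_nonneg r)
    rw [mul_sub] at hdiff
    push_cast
    linarith [tangent_le_mathieuTerm r n]
  rw [((summable_nat_add_iff 1).2 (summable_mathieuTerm 0)).tsum_sub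
      ((summable_nat_add_iff 1).2 (summable_mathieuTerm r))] at htail
  have hfirst : mathieuTerm 0 0 - mathieuTerm r 0 =
      r ^ 2 * (2 * (2 + r ^ 2) / (1 + r ^ 2) ^ 2) := by
    simp only [mathieuTerm]
    field_simp
    ring
  have hlast : H ((1 : ℕ) + 1) = r ^ 2 * (4 / 25) := by
    norm_num [hH]
  have h0 := mathieuS_eq_sum_add_tsum 0 1
  have hr := mathieuS_eq_sum_add_tsum r 1
  rw [Finset.sum_range_one] at h0 hr
  rw [hlast] at htail
  rw [mathieuSlope, mul_add]
  linarith

theorem mathieuDenom_zero_add_le {a t : ℝ} (ha : 0 < a) (ha1 : a ≤ 1) (ht : 0 ≤ t) :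
    mathieuDenom 0 0 a + t * (1 - 1 / (4 * (t + a))) ≤ mathieuDenom t t (t + a) := by
  have hgap : 0 ≤ t * (1 - a) / (12 * a * (t + a)) := by
    have := sub_nonneg.2 ha1
    positivity
  rw [← sub_nonneg]
  refine hgap.trans_eq ?_
  unfold mathieuDenom
  field_simp
  ring

theorem one_div_add_lt_sub {Z k d t : ℝ} (hZ : 0 < Z) (hd : 0 ≤ d) (ht : 0 < t)
    (h : k < d * Z * (Z - t * k)) : 1 / (1 / Z + t * d) < Z - t * k := by
  have hpos : 0 < 1 / Z + t * d := by positivity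
  rw [div_lt_iff₀ hpos]
  have hgap : 0 < t * (d * Z * (Z - t * k) - k) / Z :=
    div_pos (mul_pos ht (sub_pos.2 h)) hZ
  rw [← sub_pos]
  refine hgap.trans_eq ?_
  field_simp
  ring

theorem mul_mathieuSlope_le {t : ℝ} (ht : 0 ≤ t) (ht2 : t ≤ 1 / 2) :
    t * mathieuSlope t ≤ 12 / 5 := by
  have heq : t * mathieuSlope t = 2 - 2 / (1 + t) ^ 2 + 4 / 25 * t := by
    unfold mathieuSlope
    field_simp
    ring
  have hpos : 0 < 2 / (1 + t) ^ 2 := by positivity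
  linarith

theorem mathieuSlope_lt {t : ℝ} (ht : 0 ≤ t) (ht2 : t ≤ 1 / 2) :
    mathieuSlope t <
      (t + 37 / 50) / (t + 99 / 100) * (12 / 5) * (12 / 5 - t * mathieuSlope t) := by
  have hpoly : 0 < 0.144 + 0.43984 * t - 0.80032 * t ^ 2 - 0.25216 * t ^ 3 - 0.384 * t ^ 4 := by
    have hsub := sub_nonneg.2 ht2
    nlinarith [mul_nonneg ht hsub, mul_nonneg (pow_nonneg ht 2) hsub,
      mul_nonneg (pow_nonneg ht 3) hsub]
  have hden : 0 < (t + 99 / 100) * (1 + t) ^ 2 := by positivity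
  rw [← sub_pos]
  refine (div_pos hpoly hden).trans_eq ?_
  unfold mathieuSlope
  field_simp
  ring

theorem mathieuSlope_lt_mul {t a Z : ℝ} (ht : 0 ≤ t) (ht2 : t ≤ 1 / 2) (ha : 99 / 100 ≤ a)
    (hZ : 12 / 5 ≤ Z) :
    mathieuSlope t < (1 - 1 / (4 * (t + a))) * Z * (Z - t * mathieuSlope t) := by
  have hd : (t + 37 / 50) / (t + 99 / 100) ≤ 1 - 1 / (4 * (t + a)) := by
    calc (t + 37 / 50) / (t + 99 / 100) = 1 - 1 / (4 * (t + 99 / 100)) := by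
          field_simp
          ring
      _ ≤ 1 - 1 / (4 * (t + a)) := by gcongr
  have hd0 : 0 ≤ 1 - 1 / (4 * (t + a)) := hd.trans' (by positivity)
  have hsub : 0 ≤ 12 / 5 - t * mathieuSlope t := sub_nonneg.2 (mul_mathieuSlope_le ht ht2)
  calc mathieuSlope t
      < (t + 37 / 50) / (t + 99 / 100) * (12 / 5) * (12 / 5 - t * mathieuSlope t) :=
        mathieuSlope_lt ht ht2
    _ ≤ (1 - 1 / (4 * (t + a))) * Z * (Z - t * mathieuSlope t) := by gcongr

theorem mathieuBound_mathieuA_lt_mathieuS_of_sq_le {r : ℝ} (hr : r ≠ 0) (hr2 : r ^ 2 ≤ 1 / 2) :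
    mathieuBound mathieuA r < mathieuS r := by
  have hA := le_mathieuA
  have hA1 := mathieuA_lt
  have hZ := lt_riemannZeta_three
  norm_num at hA hA1 hZ
  have hS : 12 / 5 ≤ mathieuS 0 := by rw [mathieuS_zero]; linarith
  have ht : 0 < r ^ 2 := by positivity
  have hd : 0 ≤ 1 - 1 / (4 * (r ^ 2 + mathieuA)) := by
    rw [sub_nonneg, div_le_one₀ (by linarith)]
    linarith
  have hden : 1 / mathieuS 0 + r ^ 2 * (1 - 1 / (4 * (r ^ 2 + mathieuA))) ≤
      mathieuDenom (r ^ 2) (r ^ 2) (r ^ 2 + mathieuA) := by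
    rw [← mathieuBound_mathieuA_zero, mathieuBound_zero, one_div_one_div]
    exact mathieuDenom_zero_add_le (by linarith) (by linarith) ht.le
  calc mathieuBound mathieuA r
      ≤ 1 / (1 / mathieuS 0 + r ^ 2 * (1 - 1 / (4 * (r ^ 2 + mathieuA)))) :=
        one_div_le_one_div_of_le (by positivity) hden
    _ < mathieuS 0 - r ^ 2 * mathieuSlope (r ^ 2) :=
        one_div_add_lt_sub (by linarith) hd ht (mathieuSlope_lt_mul ht.le hr2 (by linarith) hS)
    _ ≤ mathieuS r := mathieuS_zero_sub_le r

end NearZero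

section Optimality

theorem exists_mathieuBound_eq_mathieuBound_zero {a c : ℝ} (ha : 0 < a) (hc : c < a) :
    ∃ r, 0 < r ∧ mathieuBound c r = mathieuBound a 0 := by
  set g : ℝ → ℝ := fun t => (t + a⁻¹ / 12) * (t + c) - (4 * t + 1) / 12 with hg
  obtain ⟨s, hs, hsc, hgs⟩ : ∃ s, 0 ≤ s ∧ 0 ≤ s + c ∧ g s < 0 := by
    rcases le_total c 0 with hc0 | hc0
    · refine ⟨-c, by linarith, by linarith, ?_⟩
      simp only [hg, neg_add_cancel, mul_zero]
      linarith
    · refine ⟨0, le_rfl, by linarith, ?_⟩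
      have : a⁻¹ * c < 1 := by rwa [inv_mul_lt_one₀ ha]
      simp only [hg]
      linarith
  have hgs1 : 0 ≤ g (s + 1) := by
    have hprod : (s + 1) * 1 ≤ (s + 1 + a⁻¹ / 12) * (s + 1 + c) := by
      have := inv_pos.2 ha
      exact mul_le_mul (by linarith) (by linarith) (by norm_num) (by positivity)
    simp only [hg]
    linarith
  obtain ⟨t, ⟨hst, -⟩, hgt⟩ := intermediate_value_Ioc (by linarith : s ≤ s + 1)
    (by fun_prop : ContinuousOn g (Set.Icc s (s + 1))) ⟨hgs, hgs1⟩
  have ht : 0 < t := hs.trans_lt hst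
  have htc : 0 < t + c := by linarith
  have hcorr : (4 * t + 1) / 12 * (t + c)⁻¹ = t + a⁻¹ / 12 := by
    simp only [hg] at hgt
    rw [← div_eq_mul_inv, div_eq_iff htc.ne']
    linarith
  refine ⟨√t, Real.sqrt_pos.2 ht, ?_⟩
  rw [mathieuBound, mathieuBound, Real.sq_sqrt ht.le, hcorr]
  congr 1
  ring_nf

theorem mathieuA_le_of_forall_mathieuBound_lt {a : ℝ}
    (h : ∀ r : ℝ, 0 < r → mathieuBound a r < mathieuS r) : mathieuA ≤ a := by
  by_contra! ha
  have hA : 0 < mathieuA := lt_of_lt_of_le (by norm_num) le_mathieuA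
  obtain ⟨r, hr, heq⟩ := exists_mathieuBound_eq_mathieuBound_zero hA ha
  refine (h r hr).not_ge ?_
  rw [heq, mathieuBound_mathieuA_zero]
  exact mathieuS_le_mathieuS_zero r

theorem le_of_forall_mathieuS_lt_mathieuBound {b : ℝ}
    (h : ∀ r : ℝ, 0 < r → mathieuS r < mathieuBound b r) : b ≤ 13 / 30 := by
  have hlim : Tendsto (fun r : ℝ => 13 / 30 + 8 / 15 / (r ^ 2 + 1 / 2)) atTop (𝓝 (13 / 30)) := by
    have hden : Tendsto (fun r : ℝ => r ^ 2 + 1 / 2) atTop atTop :=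
      tendsto_atTop_add_const_right _ _ (tendsto_pow_atTop two_ne_zero)
    simpa using (tendsto_const_nhds (x := (13 / 30 : ℝ))).add
      ((tendsto_const_nhds (x := (8 / 15 : ℝ))).div_atTop hden)
  refine ge_of_tendsto hlim ?_
  filter_upwards [eventually_gt_atTop 0] with r hr
  by_contra! hb
  have hc : 0 ≤ 8 / 15 / (r ^ 2 + 1 / 2) := by positivity
  have hanti : mathieuBound b r < mathieuBound (13 / 30 + 8 / 15 / (r ^ 2 + 1 / 2)) r :=
    mathieuBound_strictAntiOn r (by rw [Set.mem_Ici]; linarith) (by rw [Set.mem_Ici]; linarith) hb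
  exact lt_asymm (h r hr) (hanti.trans (mathieuBound_add_div_lt_mathieuS r))

end Optimality

theorem theorem1 :
    (∀ r : ℝ, 0 < r →
      Summable (mathieuTerm r) ∧
      mathieuBound mathieuA r < mathieuS r ∧
      mathieuS r < mathieuBound (13 / 30) r) ∧
    (∀ a : ℝ, (∀ r : ℝ, 0 < r → mathieuBound a r < mathieuS r) → mathieuA ≤ a) ∧
    (∀ b : ℝ, (∀ r : ℝ, 0 < r → mathieuS r < mathieuBound b r) → b ≤ 13 / 30) ∧
    (0.9915168156 ≤ mathieuA ∧ mathieuA < 0.9915168157) := by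
  refine ⟨fun r hr => ⟨summable_mathieuTerm r, ?_, mathieuS_lt_mathieuBound hr.ne'⟩,
    fun a => mathieuA_le_of_forall_mathieuBound_lt, fun b => le_of_forall_mathieuS_lt_mathieuBound,
    le_mathieuA, mathieuA_lt⟩
  rcases le_total (r ^ 2) (1 / 2) with hr2 | hr2
  · exact mathieuBound_mathieuA_lt_mathieuS_of_sq_le hr.ne' hr2
  · exact mathieuBound_mathieuA_lt_mathieuS_of_le_sq hr2
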